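/- Let $d\ge 2$ be an integer. An \emph{Archimedean generator} is a continuous function $\psi:[0,\infty)\to[0,\infty)$ that is strictly decreasing on $\{\psi>0\}$ and satisfies $\psi(0)=1$ and $\lim_{x\to\infty}\psi(x)=0$. It is \emph{$d$-monotone} if it is $d-2$ times differentiable on $(0,\infty)$ with $(-1)^k\psi^{(k)}\ge 0$ there for $k=0,\dots,d-2$, and $(-1)^{d-2}\psi^{(d-2)}$ is non-increasing and convex on $(0,\infty)$. A positive measurable function $f$ on $(0,\infty)$ is in $\mathrm{RV}_{\rho}$, $\rho\in\mathbb R$, if $\lim_{x\to\infty}f(cx)/f(x)=c^{\rho}$ for every $c>0$; it is in $\mathrm{RV}_{-\infty}$ if this limit is $0$ for every $c>1$ and $\infty$ for every $0<c<1$. For distribution functions $F,G$ on $\mathbb R$ with $G$ non-degenerate (not the distribution function of a point mass), $F\in\mathrm{MDA}(G)$ means that there are $c_n>0$ and $d_n\in\mathbb R$ such that $F(c_nx+d_n)^n\to G(x)$ as $n\to\infty$ at every continuity point $x$ of $G$. For $\alpha>0$, let $\Psi_\alpha(x)=\exp\{-(-x)^{\alpha}\}$ for $x<0$ and $\Psi_\alpha(x)=1$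 for $x\ge 0$ (the Weibull extreme value distribution). Let $\psi$ be a $d$-monotone Archimedean generator, and let $\tilde\psi$ be the distribution function with $\tilde\psi(x)=\psi(-x)$ for $x\le 0$ and $\tilde\psi(x)=1$ for $x>0$. Then: (i) If the function $x\mapsto 1-\psi(1/x)$ on $(0,\infty)$ is in $\mathrm{RV}_{-\alpha}$ for some $\alpha\in\mathbb R\cup\{\infty\}$, then $\alpha\in[0,1]$. (In particular it is never in $\mathrm{RV}_{-\infty}$.) (ii) If $\tilde\psi\in\mathrm{MDA}(G)$ for some non-degenerate distribution function $G$, then $\tilde\psi\in\mathrm{MDA}(\Psi_\alpha)$ for some $\alpha\in(0,1]$. -/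

import Mathlib

open Filter Topology Set

noncomputable section

namespace ArchEVT

/-- An Archimedean generator `ψ : [0,∞) → [0,∞)`, represented by a function on `ℝ` of which only
the values on `[0,∞)` are used. -/
structure IsArchimedeanGenerator (ψ : ℝ → ℝ) : Prop where
  nonneg : ∀ x, 0 ≤ x → 0 ≤ ψ x
  continuousOn : ContinuousOn ψ (Ici 0)
  strictAntiOn : StrictAntiOn ψ {x | 0 ≤ x ∧ 0 < ψ x}
  map_zero : ψ 0 = 1
  tendsto_zero : Tendsto ψ atTop (𝓝 0)

/-- `d`-monotonicity (for `d ≥ 2`) of a function on `[0,∞)`: it is `d - 2` times differentiable in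
`(0,∞)`, the derivatives alternate in sign, and `(-1)^(d-2) f^(d-2)` is non-increasing and
convex in `(0,∞)`. -/
structure IsDMonotone (d : ℕ) (f : ℝ → ℝ) : Prop where
  two_le : 2 ≤ d
  differentiableOn : ∀ k, k < d - 2 → DifferentiableOn ℝ (iteratedDeriv k f) (Ioi 0)
  sign : ∀ k, k ≤ d - 2 → ∀ x, 0 < x → 0 ≤ (-1 : ℝ) ^ k * iteratedDeriv k f x
  antitoneOn : AntitoneOn (fun x => (-1 : ℝ) ^ (d - 2) * iteratedDeriv (d - 2) f x) (Ioi 0)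
  convexOn : ConvexOn ℝ (Ioi 0) (fun x => (-1 : ℝ) ^ (d - 2) * iteratedDeriv (d - 2) f x)

/-- `f ∈ RV_ρ`: a positive, measurable function on `(0,∞)`, regularly varying at infinity with
real index `ρ`. -/
structure IsRegularlyVarying (f : ℝ → ℝ) (ρ : ℝ) : Prop where
  pos : ∀ x, 0 < x → 0 < f x
  measurable : Measurable (fun x : Ioi (0 : ℝ) => f x)
  tendsto : ∀ c : ℝ, 0 < c → Tendsto (fun x => f (c * x) / f x) atTop (𝓝 (c ^ ρ))

/-- `f ∈ RV_{-∞}`: a positive, measurable function on `(0,∞)`, rapidly varying at infinity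
with index `-∞`. -/
structure IsRapidlyVarying (f : ℝ → ℝ) : Prop where
  pos : ∀ x, 0 < x → 0 < f x
  measurable : Measurable (fun x : Ioi (0 : ℝ) => f x)
  tendsto_zero : ∀ c : ℝ, 1 < c → Tendsto (fun x => f (c * x) / f x) atTop (𝓝 0)
  tendsto_atTop : ∀ c : ℝ, 0 < c → c < 1 → Tendsto (fun x => f (c * x) / f x) atTop atTop

/-- (Cumulative) probability distribution functions on the real line. -/
structure IsDistributionFunction (F : ℝ → ℝ) : Prop where
  monotone : Monotone F
  rightContinuous : ∀ x, ContinuousWithinAt F (Ici x) x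
  tendsto_atBot : Tendsto F atBot (𝓝 0)
  tendsto_atTop : Tendsto F atTop (𝓝 1)

/-- A distribution function is degenerate if it is that of a point mass. -/
def IsDegenerate (G : ℝ → ℝ) : Prop :=
  ∃ a : ℝ, ∀ x, G x = if a ≤ x then 1 else 0

/-- Weak convergence of distribution functions: convergence at all continuity points of the
limit. -/
def WeaklyConverges (F : ℕ → ℝ → ℝ) (G : ℝ → ℝ) : Prop :=
  ∀ x, ContinuousAt G x → Tendsto (fun n => F n x) atTop (𝓝 (G x))

/-- `F ∈ MDA(G)`: `F` and `G` are distribution functions, `G` is non-degenerate, and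
`F^n(c_n x + d_n) → G(x)` weakly for some `c_n > 0` and `d_n ∈ ℝ`. -/
structure InMDA (F G : ℝ → ℝ) : Prop where
  left : IsDistributionFunction F
  right : IsDistributionFunction G
  nondegenerate : ¬ IsDegenerate G
  exists_norming : ∃ c b : ℕ → ℝ, (∀ n, 0 < c n) ∧
    WeaklyConverges (fun n x => F (c n * x + b n) ^ n) G

/-- The Weibull extreme value distribution function `Ψ_α`. -/
def weibullDF (α : ℝ) (x : ℝ) : ℝ :=
  if x < 0 then Real.exp (-((-x) ^ α)) else 1

/-- `ψ̃(x) = ψ(-x)` as a distribution function on `(-∞,0]`, hence equal to `1` on `(0,∞)`. -/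
def reflectedDF (ψ : ℝ → ℝ) (x : ℝ) : ℝ :=
  if x ≤ 0 then ψ (-x) else 1

end ArchEVT

end

/-! If `ψ` is convex on `[0,∞)` with `ψ 0 = 1`, then `h = 1 - ψ` is concave with `h 0 = 0`, so
`h (y / 2)` lies between `h y / 2` and `h y`. If `h (1 / x)` is regularly varying with index `-α`,
this reads `1 / 2 ≤ 2 ^ (-α) ≤ 1`, which gives (i).

For (ii), let `F` be the reflected distribution function and `F (c n * x + b n) ^ n → G x`. The
functions `n * (1 - F (c n * x + b n))` are concave in `x`, and they converge to `-log (G x)`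
wherever `G` is continuous and positive. Concavity makes their values at a far left point at most
a fixed multiple of those at a nearer one; hence `G` never vanishes, it has a finite right
endpoint, and this endpoint is the limit of `-b n / c n`, the point where the `n`-th tail starts.
Moving that starting point to `0` gives `n * h (c n * y) → k y` for `y > 0`, with `k` concave,
unbounded and therefore strictly increasing. Choosing `n ~ k 1 / h s` as `s → 0` turns this into
`h (t * s) / h s → k t / k 1`, a multiplicative function and hence a power `t ^ α` with `α > 0`;
by (i), `α ≤ 1`. Rescaling `c n` normalises `k` to `y ^ α`, which is the Weibull limit. -/

namespace ArchEVT

section Concave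

theorem secant_le_of_concaveOn {s : Set ℝ} {f : ℝ → ℝ} (hf : ConcaveOn ℝ s f) {x y z : ℝ}
    (hx : x ∈ s) (hz : z ∈ s) (hxy : x < y) (hyz : y < z) :
    (z - y) * f x + (y - x) * f z ≤ (z - x) * f y := by
  have h := hf.neg.secant_mono_aux1 hx hz hxy hyz
  simp only [Pi.neg_apply, mul_neg] at h
  linarith

theorem sub_mul_le_sub_mul_of_concaveOn {s : Set ℝ} {f : ℝ → ℝ} (hf : ConcaveOn ℝ s f)
    {x y z : ℝ} (hx : x ∈ s) (hz : z ∈ s) (hfx : 0 ≤ f x) (hxy : x < y) (hyz : y < z) :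
    (y - x) * f z ≤ (z - x) * f y := by
  linarith [secant_le_of_concaveOn hf hx hz hxy hyz, mul_nonneg (sub_nonneg.2 hyz.le) hfx]

theorem monotoneOn_of_concaveOn_of_nonneg {a : ℝ} {f : ℝ → ℝ} (hf : ConcaveOn ℝ (Ici a) f)
    (hf0 : ∀ x ∈ Ici a, 0 ≤ f x) : MonotoneOn f (Ici a) := by
  intro x hx y hy hxy
  by_contra! hlt
  have hxy' : x < y := hxy.lt_of_ne (by rintro rfl; exact lt_irrefl _ hlt)
  obtain ⟨z, hz, hyz⟩ := (((tendsto_id.atTop_mul_const (sub_pos.2 hlt)).eventually_gt_atTop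
    (y * f x - x * f y)).and (eventually_gt_atTop y)).exists
  have hza : z ∈ Ici a := le_trans hy hyz.le
  have hsecant := secant_le_of_concaveOn hf hx hza hxy' hyz
  have hfz := mul_nonneg (sub_nonneg.2 hxy) (hf0 z hza)
  simp only [id] at hz
  linarith

theorem strictMonoOn_of_concaveOn_of_tendsto_atTop {s : Set ℝ} {f : ℝ → ℝ}
    (hf : ConcaveOn ℝ s f) (hs : s ∈ (atTop : Filter ℝ)) (htop : Tendsto f atTop atTop) :
    StrictMonoOn f s := by
  intro x hx y hy hxy
  obtain ⟨z, ⟨hfz, hyz⟩, hz⟩ :=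
    (((htop.eventually_gt_atTop (f y)).and (eventually_gt_atTop y)).and hs).exists
  exact hf.strictMonoOn hz hyz hfz ⟨hx, hxy.le⟩ ⟨hy, self_mem_Iic⟩ hxy

theorem concaveOn_of_tendsto {ι : Type*} {l : Filter ι} [l.NeBot] {s : Set ℝ}
    {φ : ι → ℝ → ℝ} {f : ℝ → ℝ} (hφ : ∀ i, ConcaveOn ℝ s (φ i)) (hs : Convex ℝ s)
    (hlim : ∀ x ∈ s, Tendsto (fun i => φ i x) l (𝓝 (f x))) : ConcaveOn ℝ s f :=
  ⟨hs, fun x hx y hy a b ha hb hab => le_of_tendsto_of_tendsto'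
    (((hlim x hx).const_smul a).add ((hlim y hy).const_smul b))
    (hlim _ (hs hx hy ha hb hab)) fun i => (hφ i).2 hx hy ha hb hab⟩

theorem convexOn_closure {E : Type*} [AddCommGroup E] [Module ℝ E] [TopologicalSpace E]
    [IsTopologicalAddGroup E] [ContinuousConstSMul ℝ E] {s : Set E} {f : E → ℝ}
    (hf : ConvexOn ℝ s f) (hcont : ContinuousOn f (closure s)) : ConvexOn ℝ (closure s) f := by
  refine ⟨hf.1.closure, fun x hx y hy a b ha hb hab => ?_⟩
  have hmem : (x, y) ∈ closure (s ×ˢ s) := by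
    rw [closure_prod_eq]
    exact ⟨hx, hy⟩
  have hcombo : ContinuousWithinAt (fun p : E × E => f (a • p.1 + b • p.2)) (s ×ˢ s) (x, y) :=
    (hcont _ (hf.1.closure hx hy ha hb hab)).comp (t := closure s)
      (f := fun p : E × E => a • p.1 + b • p.2) (by fun_prop)
      fun p hp => subset_closure (hf.1 hp.1 hp.2 ha hb hab)
  have hfst : ContinuousWithinAt (fun p : E × E => f p.1) (s ×ˢ s) (x, y) :=
    (hcont x hx).comp (t := closure s) (f := Prod.fst) (by fun_prop)
      fun p hp => subset_closure hp.1
  have hsnd : ContinuousWithinAt (fun p : E × E => f p.2) (s ×ˢ s) (x, y) :=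
    (hcont y hy).comp (t := closure s) (f := Prod.snd) (by fun_prop)
      fun p hp => subset_closure hp.2
  exact hcombo.closure_le hmem ((hfst.const_smul a).add (hsnd.const_smul b))
    fun p hp => hf.2 hp.1 hp.2 ha hb hab

theorem IsDMonotone.convexOn_Ioi {d : ℕ} {f : ℝ → ℝ} (hf : IsDMonotone d f) :
    ConvexOn ℝ (Ioi 0) f := by
  obtain ⟨m, rfl⟩ := Nat.exists_eq_add_of_le' hf.two_le
  obtain ⟨-, hdiff, hsign, hanti, hconv⟩ := hf
  simp only [Nat.add_sub_cancel] at hdiff hsign hanti hconv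
  rcases m with _ | _ | m
  · simpa using hconv
  · have hf' : DifferentiableOn ℝ f (Ioi 0) := by simpa using hdiff 0 one_pos
    refine MonotoneOn.convexOn_of_deriv (convex_Ioi 0) hf'.continuousOn (by simpa using hf') ?_
    rw [interior_Ioi]
    exact fun x hx y hy hxy => by simpa using hanti hx hy hxy
  · have hf' : DifferentiableOn ℝ f (Ioi 0) := by simpa using hdiff 0 (by lia)
    have hf'' : DifferentiableOn ℝ (deriv f) (Ioi 0) := by simpa using hdiff 1 (by lia)
    refine convexOn_of_deriv2_nonneg (convex_Ioi 0) hf'.continuousOn (by simpa using hf')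
      (by simpa using hf'') ?_
    rw [interior_Ioi]
    exact fun x hx => by simpa [iteratedDeriv_eq_iterate] using hsign 2 (by lia) x hx

end Concave

section RegularVariationIndex

variable {f : ℝ → ℝ}

theorem div_mem_Icc_of_concaveOn (hf : ConcaveOn ℝ (Ici 0) f) (hf0 : 0 ≤ f 0)
    (hpos : ∀ x, 0 < x → 0 < f x⁻¹) {x : ℝ} (hx : 0 < x) :
    f (2 * x)⁻¹ / f x⁻¹ ∈ Icc (1 / 2 : ℝ) 1 := by
  have hnonneg : ∀ y ∈ Ici (0 : ℝ), 0 ≤ f y := fun y hy => by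
    rcases (mem_Ici.1 hy).eq_or_lt with rfl | hy
    · exact hf0
    · simpa using (hpos y⁻¹ (inv_pos.2 hy)).le
  have hx' : 0 < x⁻¹ := inv_pos.2 hx
  have hhalf : (2 * x)⁻¹ = x⁻¹ / 2 := by rw [mul_inv]; ring
  rw [hhalf]
  constructor
  · have hsecant := sub_mul_le_sub_mul_of_concaveOn hf self_mem_Ici hx'.le hf0 (half_pos hx')
      (half_lt_self hx')
    rw [le_div_iff₀ (hpos x hx)]
    nlinarith
  · rw [div_le_one (hpos x hx)]
    exact monotoneOn_of_concaveOn_of_nonneg hf hnonneg (half_pos hx').le hx'.le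
      (half_le_self hx'.le)

theorem IsRegularlyVarying.mem_Icc_of_concaveOn {α : ℝ}
    (h : IsRegularlyVarying (fun x => f x⁻¹) (-α)) (hf : ConcaveOn ℝ (Ici 0) f)
    (hf0 : 0 ≤ f 0) : α ∈ Icc (0 : ℝ) 1 := by
  have hmem : (2 : ℝ) ^ (-α) ∈ Icc ((2 : ℝ) ^ (-1 : ℝ)) (2 ^ (0 : ℝ)) := by
    rw [Real.rpow_neg_one, Real.rpow_zero, ← one_div]
    exact isClosed_Icc.mem_of_tendsto (h.tendsto 2 two_pos)
      ((eventually_gt_atTop 0).mono fun x hx => div_mem_Icc_of_concaveOn hf hf0 h.pos hx)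
  rw [mem_Icc, Real.rpow_le_rpow_left_iff one_lt_two,
    Real.rpow_le_rpow_left_iff one_lt_two] at hmem
  exact ⟨by linarith, by linarith⟩

theorem not_isRapidlyVarying_of_concaveOn (hf : ConcaveOn ℝ (Ici 0) f) (hf0 : 0 ≤ f 0) :
    ¬ IsRapidlyVarying (fun x => f x⁻¹) := fun h => by
  have hmem : (0 : ℝ) ∈ Icc (1 / 2 : ℝ) 1 :=
    isClosed_Icc.mem_of_tendsto (h.tendsto_zero 2 one_lt_two)
      ((eventually_gt_atTop 0).mono fun x hx => div_mem_Icc_of_concaveOn hf hf0 h.pos hx)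
  norm_num at hmem

end RegularVariationIndex

section MonotoneLimits

variable {ι A B : Type*} {l : Filter ι} [LinearOrder A] [TopologicalSpace A] [OrderTopology A]
  [DenselyOrdered A] [NoMinOrder A] [NoMaxOrder A] [LinearOrder B] [TopologicalSpace B]
  [OrderTopology B] {φ : ι → A → B} {γ : A → B} {a : A} {r : ι → A}

theorem tendsto_comp_of_monotone (hφ : ∀ i, Monotone (φ i))
    (hlim : ∀ᶠ x in 𝓝 a, Tendsto (fun i => φ i x) l (𝓝 (γ x))) (hγ : ContinuousAt γ a)
    (hr : Tendsto r l (𝓝 a)) : Tendsto (fun i => φ i (r i)) l (𝓝 (γ a)) := by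
  refine tendsto_order.2 ⟨fun b hb => ?_, fun b hb => ?_⟩
  · obtain ⟨x, ⟨hx, hbx⟩, hxa⟩ := (((hlim.and (hγ.eventually_const_lt hb)).filter_mono
      nhdsWithin_le_nhds).and (self_mem_nhdsWithin (s := Iio a))).exists
    filter_upwards [hx.eventually_const_lt hbx, hr.eventually_const_lt hxa] with i hφx hxr
      using hφx.trans_le (hφ i hxr.le)
  · obtain ⟨x, ⟨hx, hbx⟩, hax⟩ := (((hlim.and (hγ.eventually_lt_const hb)).filter_mono
      nhdsWithin_le_nhds).and (self_mem_nhdsWithin (s := Ioi a))).exists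
    filter_upwards [hx.eventually_lt_const hbx, hr.eventually_lt_const hax] with i hφx hrx
      using (hφ i hrx.le).trans_lt hφx

theorem tendsto_of_tendsto_comp_of_monotone {s : Set A} (hφ : ∀ i, Monotone (φ i))
    (hlim : ∀ x ∈ s, Tendsto (fun i => φ i x) l (𝓝 (γ x))) (hγ : StrictMonoOn γ s)
    (hs : s ∈ 𝓝 a) (hr : Tendsto (fun i => φ i (r i)) l (𝓝 (γ a))) : Tendsto r l (𝓝 a) := by
  have has : a ∈ s := mem_of_mem_nhds hs
  have hev : ∀ᶠ x in 𝓝 a, x ∈ s := hs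
  refine tendsto_order.2 ⟨fun b hb => ?_, fun b hb => ?_⟩
  · obtain ⟨x, hxs, hbx, hxa⟩ :=
      ((hev.filter_mono nhdsWithin_le_nhds).and (Ioo_mem_nhdsLT hb)).exists
    filter_upwards [(hlim x hxs).eventually_lt hr (hγ hxs has hxa)] with i hi
      using hbx.trans ((hφ i).reflect_lt hi)
  · obtain ⟨x, hxs, hax, hxb⟩ :=
      ((hev.filter_mono nhdsWithin_le_nhds).and (Ioo_mem_nhdsGT hb)).exists
    filter_upwards [hr.eventually_lt (hlim x hxs) (hγ has hxs hax)] with i hi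
      using ((hφ i).reflect_lt hi).trans hxb

end MonotoneLimits

section RegularVariation

variable {h k ρ : ℝ → ℝ} {c : ℕ → ℝ}

theorem exists_rpow_of_map_mul (hpos : ∀ x, 0 < x → 0 < ρ x) (hcont : ContinuousOn ρ (Ioi 0))
    (hmul : ∀ x y, 0 < x → 0 < y → ρ (x * y) = ρ x * ρ y) :
    ∃ α : ℝ, ∀ x, 0 < x → ρ x = x ^ α := by
  have hexp : ∀ t, 0 < ρ (Real.exp t) := fun t => hpos _ (Real.exp_pos t)
  let L : ℝ →+ ℝ := AddMonoidHom.mk' (fun t => Real.log (ρ (Real.exp t))) fun s t => by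
    rw [Real.exp_add, hmul _ _ (Real.exp_pos _) (Real.exp_pos _),
      Real.log_mul (hexp s).ne' (hexp t).ne']
  have hL : Continuous L :=
    (hcont.comp_continuous Real.continuous_exp Real.exp_pos).log fun t => (hexp t).ne'
  refine ⟨L 1, fun x hx => ?_⟩
  have hlinear : L (Real.log x) = Real.log x * L 1 := by
    simpa using map_real_smul L hL (Real.log x) 1
  have hlog : L (Real.log x) = Real.log (ρ x) :=
    congrArg (fun y => Real.log (ρ y)) (Real.exp_log hx)
  rw [Real.rpow_def_of_pos hx, ← hlinear, hlog, Real.exp_log (hpos x hx)]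

theorem map_mul_of_tendsto_div (hh : ∀ x, 0 < x → 0 < h x)
    (hρ : ∀ t, 0 < t → Tendsto (fun s => h (t * s) / h s) (𝓝[>] 0) (𝓝 (ρ t))) {t u : ℝ}
    (ht : 0 < t) (hu : 0 < u) : ρ (t * u) = ρ t * ρ u := by
  have hscale : Tendsto (fun s => u * s) (𝓝[>] 0) (𝓝[>] 0) :=
    tendsto_nhdsWithin_iff.2 ⟨(continuous_const_mul u).tendsto' 0 0 (mul_zero u) |>.mono_left
      nhdsWithin_le_nhds, eventually_mem_nhdsWithin.mono fun s hs => mul_pos hu hs⟩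
  refine tendsto_nhds_unique_of_eventuallyEq (hρ _ (mul_pos ht hu))
    (((hρ t ht).comp hscale).mul (hρ u hu)) ?_
  filter_upwards [self_mem_nhdsWithin] with s hs
  rw [Function.comp_apply, div_mul_div_cancel₀ (hh _ (mul_pos hu hs)).ne', mul_assoc]

theorem tendsto_nhdsGT_zero_of_tendsto_natCast_mul (hm : Monotone h)
    (hh : ∀ y, 0 < y → 0 < h y) (hc : ∀ n, 0 < c n) {κ : ℝ}
    (hlim : Tendsto (fun n : ℕ => n * h (c n)) atTop (𝓝 κ)) :
    Tendsto h (𝓝[>] 0) (𝓝[>] 0) := by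
  have hzero : Tendsto (fun n => h (c n)) atTop (𝓝 0) := by
    refine (hlim.div_atTop tendsto_natCast_atTop_atTop).congr' ?_
    filter_upwards [eventually_ne_atTop 0] with n hn
    exact mul_div_cancel_left₀ _ (Nat.cast_ne_zero.2 hn)
  refine tendsto_nhdsWithin_iff.2 ⟨tendsto_order.2 ⟨fun ε hε => ?_, fun ε hε => ?_⟩,
    eventually_mem_nhdsWithin.mono fun s hs => hh s hs⟩
  · exact eventually_mem_nhdsWithin.mono fun s hs => hε.trans (hh s hs)
  · obtain ⟨n, hn⟩ := (hzero.eventually_lt_const hε).exists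
    exact mem_of_superset (Ioo_mem_nhdsGT (hc n)) fun s hs => (hm hs.2.le).trans_lt hn

theorem pos_of_tendsto_natCast_mul (hh : ∀ y, 0 < y → 0 < h y) (hc : ∀ n, 0 < c n)
    (hlim : ∀ y, 0 < y → Tendsto (fun n : ℕ => n * h (c n * y)) atTop (𝓝 (k y)))
    (hk : StrictMonoOn k (Ioi 0)) {y : ℝ} (hy : 0 < y) : 0 < k y :=
  (ge_of_tendsto' (hlim _ (half_pos hy)) fun n =>
    mul_nonneg n.cast_nonneg (hh _ (mul_pos (hc n) (half_pos hy))).le).trans_lt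
    (hk (half_pos hy) hy (half_lt_self hy))

theorem tendsto_div_of_tendsto_natCast_mul (hm : Monotone h) (hh : ∀ y, 0 < y → 0 < h y)
    (hc : ∀ n, 0 < c n)
    (hlim : ∀ y, 0 < y → Tendsto (fun n : ℕ => n * h (c n * y)) atTop (𝓝 (k y)))
    (hk : StrictMonoOn k (Ioi 0)) (hkcont : ContinuousOn k (Ioi 0)) {t : ℝ} (ht : 0 < t) :
    Tendsto (fun s => h (t * s) / h s) (𝓝[>] 0) (𝓝 (k t / k 1)) := by
  have hk1 : 0 < k 1 := pos_of_tendsto_natCast_mul hh hc hlim hk one_pos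
  have hinv : Tendsto (fun s => (h s)⁻¹) (𝓝[>] 0) atTop :=
    tendsto_inv_nhdsGT_zero.comp
      (tendsto_nhdsGT_zero_of_tendsto_natCast_mul hm hh hc (by simpa using hlim 1 one_pos))
  -- The integer `m s ~ k 1 / h s` makes `s` comparable with the norming constant `c (m s)`.
  let m : ℝ → ℕ := fun s => ⌊k 1 * (h s)⁻¹⌋₊
  let φ : ℝ → ℝ → ℝ := fun s x => m s * h (c (m s) * x)
  have hmtop : Tendsto m (𝓝[>] 0) atTop :=
    tendsto_nat_floor_atTop.comp (hinv.const_mul_atTop hk1)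
  have hmh : Tendsto (fun s => m s * h s) (𝓝[>] 0) (𝓝 (k 1)) :=
    ((tendsto_nat_floor_mul_div_atTop hk1.le).comp hinv).congr fun s => div_inv_eq_mul _ _
  have hφmono : ∀ s, Monotone (φ s) := fun s x y hxy =>
    mul_le_mul_of_nonneg_left (hm (mul_le_mul_of_nonneg_left hxy (hc _).le)) (Nat.cast_nonneg _)
  have hφlim : ∀ x ∈ Ioi (0 : ℝ), Tendsto (fun s => φ s x) (𝓝[>] 0) (𝓝 (k x)) :=
    fun x hx => (hlim x hx).comp hmtop
  have hφ : ∀ u s, φ s (u * (s / c (m s))) = m s * h (u * s) := fun u s => by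
    simp only [φ, mul_left_comm, mul_div_cancel₀ _ (hc (m s)).ne']
  have hratio : Tendsto (fun s => s / c (m s)) (𝓝[>] 0) (𝓝 1) :=
    tendsto_of_tendsto_comp_of_monotone hφmono hφlim hk (Ioi_mem_nhds one_pos)
      (hmh.congr fun s => by simpa using (hφ 1 s).symm)
  have hmt : Tendsto (fun s => m s * h (t * s)) (𝓝[>] 0) (𝓝 (k t)) :=
    (tendsto_comp_of_monotone hφmono (mem_of_superset (Ioi_mem_nhds ht) hφlim)
      (hkcont.continuousAt (Ioi_mem_nhds ht))
      (by simpa using hratio.const_mul t)).congr (hφ t)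
  refine (hmt.div hmh hk1.ne').congr' ?_
  filter_upwards [hmtop.eventually_ne_atTop 0] with s hs
  exact mul_div_mul_left _ _ (Nat.cast_ne_zero.2 hs)

theorem exists_isRegularlyVarying_of_tendsto_natCast_mul (hm : Monotone h)
    (hh : ∀ y, 0 < y → 0 < h y) (hc : ∀ n, 0 < c n)
    (hlim : ∀ y, 0 < y → Tendsto (fun n : ℕ => n * h (c n * y)) atTop (𝓝 (k y)))
    (hk : StrictMonoOn k (Ioi 0)) (hkcont : ContinuousOn k (Ioi 0)) :
    ∃ α : ℝ, 0 < α ∧ IsRegularlyVarying (fun x => h x⁻¹) (-α) ∧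
      ∀ y, 0 < y → k y = k 1 * y ^ α := by
  have hkpos : ∀ y, 0 < y → 0 < k y := fun y hy => pos_of_tendsto_natCast_mul hh hc hlim hk hy
  have hdiv := fun t ht => tendsto_div_of_tendsto_natCast_mul hm hh hc hlim hk hkcont (t := t) ht
  obtain ⟨α, hα⟩ := exists_rpow_of_map_mul (ρ := fun t => k t / k 1)
    (fun t ht => div_pos (hkpos t ht) (hkpos 1 one_pos)) (hkcont.div_const _)
    fun t u ht hu => map_mul_of_tendsto_div (ρ := fun t => k t / k 1) hh hdiv ht hu
  refine ⟨α, ?_, ⟨fun x hx => hh _ (inv_pos.2 hx), ?_, fun t ht => ?_⟩, fun y hy => ?_⟩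
  · have htwo : 1 < (2 : ℝ) ^ α := by
      rw [← hα 2 two_pos, one_lt_div (hkpos 1 one_pos)]
      exact hk (mem_Ioi.2 one_pos) (mem_Ioi.2 two_pos) one_lt_two
    by_contra! hneg
    exact htwo.not_ge (Real.rpow_le_one_of_one_le_of_nonpos one_le_two hneg)
  · exact hm.measurable.comp measurable_subtype_coe.inv
  · have hinv := (hdiv t⁻¹ (inv_pos.2 ht)).comp tendsto_inv_atTop_nhdsGT_zero
    rw [hα _ (inv_pos.2 ht), Real.inv_rpow ht.le, ← Real.rpow_neg ht.le] at hinv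
    simpa only [Function.comp_def, mul_inv] using hinv
  · rw [← hα y hy, mul_div_cancel₀ _ (hkpos 1 one_pos).ne']

end RegularVariation


section ConcaveTail

/-- A nonnegative function that vanishes up to its left endpoint `v` and is concave from there on.
Reflecting a distribution function `F`, convex up to its right endpoint, gives the concave tail
`y ↦ 1 - F (-y)`. -/
structure IsConcaveTail (v : ℝ) (f : ℝ → ℝ) : Prop where
  nonneg : ∀ x, 0 ≤ f x
  eq_zero_of_le : ∀ x, x ≤ v → f x = 0
  concaveOn : ConcaveOn ℝ (Ici v) f

namespace IsConcaveTail

variable {v : ℝ} {f : ℝ → ℝ}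

theorem lt_of_pos (hf : IsConcaveTail v f) {x : ℝ} (hx : 0 < f x) : v < x :=
  not_le.1 fun hxv => hx.ne' (hf.eq_zero_of_le x hxv)

theorem sub_mul_le_sub_mul (hf : IsConcaveTail v f) {x y z : ℝ} (hx : v ≤ x) (hxy : x < y)
    (hyz : y < z) : (y - x) * f z ≤ (z - x) * f y :=
  sub_mul_le_sub_mul_of_concaveOn hf.concaveOn hx (hx.trans (hxy.trans hyz).le) (hf.nonneg x)
    hxy hyz

theorem monotone (hf : IsConcaveTail v f) : Monotone f := fun x y hxy => by
  rcases le_total x v with hx | hx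
  · exact (hf.eq_zero_of_le x hx).trans_le (hf.nonneg y)
  · exact monotoneOn_of_concaveOn_of_nonneg hf.concaveOn (fun x _ => hf.nonneg x) hx
      (hx.trans hxy) hxy

theorem pos (hf : IsConcaveTail v f) {x y : ℝ} (hx : 0 < f x) (hy : v < y) : 0 < f y := by
  rcases le_or_gt x y with hxy | hyx
  · exact hx.trans_le (hf.monotone hxy)
  · refine pos_of_mul_pos_right ?_ (sub_pos.2 (hy.trans hyx)).le
    exact (mul_pos (sub_pos.2 hy) hx).trans_le (hf.sub_mul_le_sub_mul le_rfl hy hyx)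

theorem const_mul_comp_affine (hf : IsConcaveTail v f) {a c : ℝ} (b : ℝ) (ha : 0 ≤ a)
    (hc : 0 < c) : IsConcaveTail ((v + b) / c) (fun x => a * f (c * x - b)) where
  nonneg x := mul_nonneg ha (hf.nonneg _)
  eq_zero_of_le x hx := by
    rw [le_div_iff₀' hc] at hx
    rw [hf.eq_zero_of_le _ (by linarith), mul_zero]
  concaveOn := by
    have hpre : (AffineMap.lineMap (-b) (c - b) : ℝ →ᵃ[ℝ] ℝ) ⁻¹' Ici v = Ici ((v + b) / c) := by
      ext x
      simp only [mem_preimage, mem_Ici, AffineMap.lineMap_apply_ring', div_le_iff₀' hc]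
      constructor <;> intro h <;> linarith
    have h := (hf.concaveOn.comp_affineMap (AffineMap.lineMap (-b) (c - b))).smul ha
    rw [hpre] at h
    refine h.congr fun x _ => ?_
    simp only [Function.comp_apply, AffineMap.lineMap_apply_ring', smul_eq_mul]
    ring_nf

end IsConcaveTail

end ConcaveTail

section ConcaveTailLimit

variable {ι : Type*} {l : Filter ι} {φ : ι → ℝ → ℝ} {v : ι → ℝ} {g : ℝ → ℝ}

theorem exists_continuousAt_mem_Ioo (hg : Monotone g) {a b : ℝ} (hab : a < b) :
    ∃ x ∈ Ioo a b, ContinuousAt g x := by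
  obtain ⟨x, hx, hxab⟩ := (hg.countable_not_continuousAt.dense_compl ℝ).exists_between hab
  exact ⟨x, hxab, not_not.1 hx⟩

theorem sub_mul_le_sub_mul_of_tendsto (hφ : ∀ i, IsConcaveTail (v i) (φ i))
    (hlim : ∀ x, ContinuousAt g x → Tendsto (fun i => φ i x) l (𝓝 (g x))) {x y z : ℝ}
    (hx : ∃ᶠ i in l, v i ≤ x) (hxy : x < y) (hyz : y < z) (hy : ContinuousAt g y)
    (hz : ContinuousAt g z) : (y - x) * g z ≤ (z - x) * g y :=
  le_of_tendsto_of_tendsto_of_frequently ((hlim z hz).const_mul _) ((hlim y hy).const_mul _)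
    (hx.mono fun i hi => (hφ i).sub_mul_le_sub_mul hi hxy hyz)

theorem eventually_lt_of_pos (hφ : ∀ i, IsConcaveTail (v i) (φ i)) (hg : Monotone g)
    (hlim : ∀ x, ContinuousAt g x → Tendsto (fun i => φ i x) l (𝓝 (g x))) {w x : ℝ}
    (hw : 0 < g w) (hwx : w < x) : ∀ᶠ i in l, v i < x := by
  obtain ⟨y, ⟨hwy, hyx⟩, hy⟩ := exists_continuousAt_mem_Ioo hg hwx
  filter_upwards [(hlim y hy).eventually_const_lt (hw.trans_le (hg hwy.le))] with i hi
    using ((hφ i).lt_of_pos hi).trans hyx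

theorem exists_continuousAt_lt_of_tendsto_atTop (hg : Monotone g) (htop : Tendsto g atTop atTop)
    (a b : ℝ) : ∃ x, a < x ∧ b < g x ∧ ContinuousAt g x := by
  obtain ⟨w, hbw, haw⟩ := ((htop.eventually_gt_atTop b).and (eventually_gt_atTop a)).exists
  obtain ⟨x, ⟨hwx, -⟩, hx⟩ := exists_continuousAt_mem_Ioo hg (lt_add_one w)
  exact ⟨x, haw.trans hwx, hbw.trans_le (hg hwx.le), hx⟩

theorem bddBelow_pos_of_tendsto [l.NeBot] (hφ : ∀ i, IsConcaveTail (v i) (φ i))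
    (hg : Monotone g) (htop : Tendsto g atTop atTop)
    (hlim : ∀ x, ContinuousAt g x → Tendsto (fun i => φ i x) l (𝓝 (g x))) :
    BddBelow {x | 0 < g x} := by
  obtain ⟨y, -, hy⟩ := exists_continuousAt_mem_Ioo hg zero_lt_one
  obtain ⟨z, hyz, hgyz, hz⟩ := exists_continuousAt_lt_of_tendsto_atTop hg htop y (g y)
  have hslope : 0 < g z - g y := sub_pos.2 hgyz
  -- The line through `(y, g y)` and `(z, g z)` is negative to the left of this quotient.
  refine ⟨min y ((y * g z - z * g y) / (g z - g y)), fun w hw => ?_⟩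
  by_contra! hlt
  obtain ⟨x, hwx, hx⟩ := exists_between hlt
  obtain ⟨hxy, hxq⟩ := lt_min_iff.1 hx
  have hchord := sub_mul_le_sub_mul_of_tendsto hφ hlim
    ((eventually_lt_of_pos hφ hg hlim hw hwx).mono fun i => le_of_lt).frequently hxy hyz hy hz
  rw [lt_div_iff₀ hslope] at hxq
  linarith

theorem tendsto_endpoint [l.NeBot] (hφ : ∀ i, IsConcaveTail (v i) (φ i)) (hg : Monotone g)
    (hg0 : ∀ x, 0 ≤ g x) (htop : Tendsto g atTop atTop)
    (hlim : ∀ x, ContinuousAt g x → Tendsto (fun i => φ i x) l (𝓝 (g x))) :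
    Tendsto v l (𝓝 (sInf {x | 0 < g x})) := by
  have hbdd : BddBelow {x | 0 < g x} := bddBelow_pos_of_tendsto hφ hg htop hlim
  have hne : {x | 0 < g x}.Nonempty := (htop.eventually_gt_atTop 0).exists
  refine tendsto_order.2 ⟨fun a ha => ?_, fun a ha => ?_⟩
  · by_contra hfreq
    have hva : ∃ᶠ i in l, v i ≤ a := (not_eventually.1 hfreq).mono fun i => not_lt.1
    obtain ⟨y, ⟨hay, hye⟩, hy⟩ := exists_continuousAt_mem_Ioo hg ha
    obtain ⟨z, hyz, hgz, hz⟩ := exists_continuousAt_lt_of_tendsto_atTop hg htop y 0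
    have hgy : g y = 0 :=
      (not_lt.1 (notMem_of_lt_csInf (s := {x | 0 < g x}) hye hbdd)).antisymm (hg0 y)
    have hchord := sub_mul_le_sub_mul_of_tendsto hφ hlim hva hay hyz hy hz
    rw [hgy, mul_zero] at hchord
    exact hchord.not_gt (mul_pos (sub_pos.2 hay) hgz)
  · obtain ⟨w, hw, hwa⟩ := exists_lt_of_csInf_lt hne ha
    exact eventually_lt_of_pos hφ hg hlim hw hwa

theorem continuousAt_of_tendsto_of_pos [l.NeBot] (hφ : ∀ i, IsConcaveTail (v i) (φ i))
    (hg : Monotone g) (hg0 : ∀ x, 0 ≤ g x)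
    (hlim : ∀ x, ContinuousAt g x → Tendsto (fun i => φ i x) l (𝓝 (g x))) {u w : ℝ}
    (hu : 0 < g u) (huw : u < w) : ContinuousAt g w := by
  obtain ⟨x, hux, hxw⟩ := exists_between huw
  have hvx : ∃ᶠ i in l, v i ≤ x :=
    ((eventually_lt_of_pos hφ hg hlim hu hux).mono fun i => le_of_lt).frequently
  set L := Function.leftLim g w
  set R := Function.rightLim g w
  have hR : 0 ≤ R := (hg0 w).trans (hg.le_rightLim le_rfl)
  have hjump : ∀ y ∈ Ioo x w, ∀ z ∈ Ioi w, (y - x) * R ≤ (z - x) * L := by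
    rintro y ⟨hxy, hyw⟩ z hwz
    obtain ⟨y', ⟨hyy', hy'w⟩, hy'⟩ := exists_continuousAt_mem_Ioo hg hyw
    obtain ⟨z', ⟨hwz', hz'z⟩, hz'⟩ := exists_continuousAt_mem_Ioo hg (mem_Ioi.1 hwz)
    have hxy' : x < y' := hxy.trans hyy'
    calc (y - x) * R ≤ (y' - x) * g z' :=
          mul_le_mul (sub_le_sub_right hyy'.le x) (hg.rightLim_le hwz') hR (sub_pos.2 hxy').le
      _ ≤ (z' - x) * g y' :=
          sub_mul_le_sub_mul_of_tendsto hφ hlim hvx hxy' (hy'w.trans hwz') hy' hz'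
      _ ≤ (z - x) * L :=
          mul_le_mul (sub_le_sub_right hz'z.le x) (hg.le_leftLim hy'w) (hg0 y')
            (sub_pos.2 (hxw.trans hwz)).le
  have hRL : (w - x) * R ≤ (w - x) * L := by
    have hz : ∀ z ∈ Ioi w, (w - x) * R ≤ (z - x) * L := fun z hz => by
      have hcont : Tendsto (fun y => (y - x) * R) (𝓝[<] w) (𝓝 ((w - x) * R)) :=
        (by fun_prop : Continuous fun y => (y - x) * R).continuousWithinAt
      exact le_of_tendsto hcont (mem_of_superset (Ioo_mem_nhdsLT hxw) fun y hy => hjump y hy z hz)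
    have hcont : Tendsto (fun z => (z - x) * L) (𝓝[>] w) (𝓝 ((w - x) * L)) :=
      (by fun_prop : Continuous fun z => (z - x) * L).continuousWithinAt
    exact ge_of_tendsto hcont (eventually_mem_nhdsWithin.mono hz)
  exact hg.continuousAt_iff_leftLim_eq_rightLim.2
    ((hg.leftLim_le_rightLim le_rfl).antisymm (le_of_mul_le_mul_left hRL (sub_pos.2 hxw)))

theorem exists_tendsto_add_endpoint [l.NeBot] (hφ : ∀ i, IsConcaveTail (v i) (φ i))
    (hg : Monotone g) (hg0 : ∀ x, 0 ≤ g x) (htop : Tendsto g atTop atTop)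
    (hlim : ∀ x, ContinuousAt g x → Tendsto (fun i => φ i x) l (𝓝 (g x))) :
    ∃ k : ℝ → ℝ, StrictMonoOn k (Ioi 0) ∧ ContinuousOn k (Ioi 0) ∧
      ∀ y, 0 < y → Tendsto (fun i => φ i (y + v i)) l (𝓝 (k y)) := by
  set e := sInf {x | 0 < g x}
  have hcont : ∀ x, e < x → ContinuousAt g x := fun x hx => by
    obtain ⟨u, hu, hux⟩ := exists_lt_of_csInf_lt (htop.eventually_gt_atTop 0).exists hx
    exact continuousAt_of_tendsto_of_pos hφ hg hg0 hlim hu hux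
  have hklim : ∀ y ∈ Ioi (0 : ℝ), Tendsto (fun i => φ i (y + v i)) l (𝓝 (g (y + e))) :=
    fun y hy => tendsto_comp_of_monotone (fun i => (hφ i).monotone)
      ((eventually_gt_nhds (lt_add_of_pos_left e hy)).mono fun x hx => hlim x (hcont x hx))
      (hcont _ (lt_add_of_pos_left e hy)) ((tendsto_endpoint hφ hg hg0 htop hlim).const_add y)
  have hconc : ConcaveOn ℝ (Ioi 0) fun y => g (y + e) :=
    concaveOn_of_tendsto (fun i => ((hφ i).concaveOn.translate_left (v i)).subset
      (fun y hy => by simpa using (mem_Ioi.1 hy).le) (convex_Ioi 0)) (convex_Ioi 0) hklim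
  exact ⟨fun y => g (y + e),
    strictMonoOn_of_concaveOn_of_tendsto_atTop hconc (Ioi_mem_atTop 0)
      (htop.comp (tendsto_atTop_add_const_right _ e tendsto_id)),
    hconc.continuousOn isOpen_Ioi, hklim⟩

end ConcaveTailLimit

section PowerLimits

variable {p : ℕ → ℝ} {a M : ℝ}

theorem tendsto_natCast_mul_one_sub_of_tendsto_pow (hp : ∀ n, 0 ≤ p n) (ha : 0 < a)
    (h : Tendsto (fun n => p n ^ n) atTop (𝓝 a)) :
    Tendsto (fun n : ℕ => n * (1 - p n)) atTop (𝓝 (-Real.log a)) := by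
  have hpos : ∀ᶠ n in atTop, 0 < p n := by
    filter_upwards [h.eventually_const_lt ha, eventually_ne_atTop 0] with n hn hn0
    exact (hp n).lt_of_ne' fun h0 => hn.ne' (by rw [h0, zero_pow hn0])
  have hmul_log : Tendsto (fun n : ℕ => n * Real.log (p n)) atTop (𝓝 (Real.log a)) :=
    (h.log ha.ne').congr fun n => Real.log_pow _ _
  have hlog : Tendsto (fun n => Real.log (p n)) atTop (𝓝 0) := by
    refine (hmul_log.div_atTop tendsto_natCast_atTop_atTop).congr' ?_
    filter_upwards [eventually_ne_atTop 0] with n hn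
    exact mul_div_cancel_left₀ _ (Nat.cast_ne_zero.2 hn)
  have hp1 : Tendsto p atTop (𝓝 1) := by
    have hexp := hlog.rexp
    rw [Real.exp_zero] at hexp
    exact hexp.congr' (hpos.mono fun n => Real.exp_log)
  have hlower : Tendsto (fun n : ℕ => p n * -(n * Real.log (p n))) atTop (𝓝 (-Real.log a)) := by
    simpa only [one_mul] using hp1.mul hmul_log.neg
  -- Squeeze with `-p log p ≤ 1 - p ≤ -log p`.
  refine tendsto_of_tendsto_of_tendsto_of_le_of_le' hlower hmul_log.neg ?_ ?_
  · filter_upwards [hpos] with n hn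
    have hle : p n * -Real.log (p n) ≤ 1 - p n := by
      have := mul_le_mul_of_nonneg_left (Real.one_sub_inv_le_log_of_pos hn) hn.le
      rw [mul_sub, mul_inv_cancel₀ hn.ne', mul_one] at this
      linarith
    linarith [mul_le_mul_of_nonneg_left hle n.cast_nonneg]
  · filter_upwards [hpos] with n hn
    linarith [mul_le_mul_of_nonneg_left (Real.log_le_sub_one_of_pos hn) n.cast_nonneg]

theorem pos_of_tendsto_pow (hM : ∀ᶠ n : ℕ in atTop, n * (1 - p n) ≤ M)
    (h : Tendsto (fun n => p n ^ n) atTop (𝓝 a)) : 0 < a := by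
  refine (Real.exp_pos (-M)).trans_le
    (le_of_tendsto_of_tendsto (Real.tendsto_one_add_div_pow_exp (-M)) h ?_)
  filter_upwards [hM, eventually_gt_atTop 0, eventually_ge_atTop ⌈M⌉₊] with n hn hn0 hnM
  have hn0' : (0 : ℝ) < n := Nat.cast_pos.2 hn0
  have hdiv : M / n ≤ 1 := (div_le_one hn0').2 (Nat.ceil_le.1 hnM)
  have hsub : 1 - p n ≤ M / n := (le_div_iff₀' hn0').2 hn
  exact pow_le_pow_left₀ (by rw [neg_div]; linarith) (by rw [neg_div]; linarith) n

end PowerLimits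

namespace IsDistributionFunction

variable {F G : ℝ → ℝ}

theorem nonneg (hG : IsDistributionFunction G) (x : ℝ) : 0 ≤ G x :=
  hG.monotone.le_of_tendsto hG.tendsto_atBot x

theorem le_one (hG : IsDistributionFunction G) (x : ℝ) : G x ≤ 1 :=
  hG.monotone.ge_of_tendsto hG.tendsto_atTop x

theorem tendsto_nhdsGT (hG : IsDistributionFunction G) (x : ℝ) :
    Tendsto G (𝓝[>] x) (𝓝 (G x)) :=
  (hG.rightContinuous x).tendsto.mono_left (nhdsWithin_mono _ Ioi_subset_Ici_self)

theorem isDegenerate_of_forall_eq_zero_or_eq_one (hG : IsDistributionFunction G)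
    (h01 : ∀ x, G x = 0 ∨ G x = 1) : IsDegenerate G := by
  have hone : ∀ {x}, 0 < G x → G x = 1 := fun {x} hx => (h01 x).resolve_left hx.ne'
  set a := sInf {x | 0 < G x}
  have hne : {x | 0 < G x}.Nonempty := (hG.tendsto_atTop.eventually_const_lt one_pos).exists
  have hbdd : BddBelow {x | 0 < G x} := by
    obtain ⟨s, hs⟩ := (hG.tendsto_atBot.eventually_lt_const one_pos).exists
    exact ⟨s, fun x hx => (hG.monotone.reflect_lt (hs.trans_eq (hone hx).symm)).le⟩
  have hgt : ∀ x, a < x → G x = 1 := fun x hx => by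
    obtain ⟨y, hy, hyx⟩ := exists_lt_of_csInf_lt hne hx
    exact hone (hy.trans_le (hG.monotone hyx.le))
  refine ⟨a, fun x => ?_⟩
  split_ifs with hx
  · refine tendsto_nhds_unique (hG.tendsto_nhdsGT x) (tendsto_const_nhds.congr' ?_)
    exact eventually_mem_nhdsWithin.mono fun y hy => (hgt y (hx.trans_lt hy)).symm
  · exact (h01 x).resolve_right fun h => hx (csInf_le hbdd (one_pos.trans_eq h.symm))

theorem exists_mem_Ioo (hG : IsDistributionFunction G) (hnd : ¬ IsDegenerate G) :
    ∃ x, G x ∈ Ioo 0 1 := by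
  by_contra! hmem
  refine hnd (hG.isDegenerate_of_forall_eq_zero_or_eq_one fun x => ?_)
  exact (hG.nonneg x).eq_or_lt.imp Eq.symm fun hx =>
    (hG.le_one x).antisymm (not_lt.1 fun hx1 => hmem x ⟨hx, hx1⟩)

theorem exists_continuousAt_mem_Ioo_pair (hG : IsDistributionFunction G)
    (hnd : ¬ IsDegenerate G) :
    ∃ x y, x < y ∧ ContinuousAt G x ∧ ContinuousAt G y ∧ 0 < G x ∧ G y < 1 := by
  obtain ⟨x, hx0, hx1⟩ := hG.exists_mem_Ioo hnd
  obtain ⟨z, hz, hxz⟩ := (((hG.tendsto_nhdsGT x).eventually_lt_const hx1).and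
    eventually_mem_nhdsWithin).exists
  obtain ⟨v, ⟨hxv, hvz⟩, hv⟩ := exists_continuousAt_mem_Ioo hG.monotone (mem_Ioi.1 hxz)
  obtain ⟨u, ⟨hxu, huv⟩, hu⟩ := exists_continuousAt_mem_Ioo hG.monotone hxv
  exact ⟨u, v, huv, hu, hv, hx0.trans_le (hG.monotone hxu.le), (hG.monotone hvz.le).trans_lt hz⟩

theorem monotone_neg_log_comp_neg (hG : IsDistributionFunction G) (hpos : ∀ x, 0 < G x) :
    Monotone fun x => -Real.log (G (-x)) := fun _ _ hxy =>
  neg_le_neg (Real.log_le_log (hpos _) (hG.monotone (neg_le_neg hxy)))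

theorem neg_log_nonneg (hG : IsDistributionFunction G) (x : ℝ) : 0 ≤ -Real.log (G x) :=
  neg_nonneg.2 (Real.log_nonpos (hG.nonneg x) (hG.le_one x))

theorem tendsto_neg_log_comp_neg_atTop (hG : IsDistributionFunction G) (hpos : ∀ x, 0 < G x) :
    Tendsto (fun x => -Real.log (G (-x))) atTop atTop :=
  tendsto_neg_atBot_atTop.comp (Real.tendsto_log_nhdsGT_zero.comp
    (tendsto_nhdsWithin_iff.2 ⟨hG.tendsto_atBot.comp tendsto_neg_atTop_atBot,
      Eventually.of_forall fun x => hpos (-x)⟩))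

end IsDistributionFunction

theorem continuousAt_neg_of_continuousAt_neg_log {G : ℝ → ℝ} (hpos : ∀ x, 0 < G x) {x : ℝ}
    (hx : ContinuousAt (fun x => -Real.log (G (-x))) x) : ContinuousAt G (-x) := by
  have hexp : (fun x => Real.exp (- -Real.log (G (-x)))) = fun x => G (-x) := by
    funext x
    rw [neg_neg, Real.exp_log (hpos _)]
  have hGneg : ContinuousAt (fun x => G (-x)) (- -x) := by
    rw [neg_neg, ← hexp]
    exact hx.neg.rexp
  simpa only [Function.comp_def, neg_neg] using hGneg.comp continuousAt_neg

section DomainOfAttraction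

variable {F G : ℝ → ℝ} {c b : ℕ → ℝ}

theorem isConcaveTail_normed (hF : IsConcaveTail 0 fun y => 1 - F (-y)) (hc : ∀ n, 0 < c n)
    (n : ℕ) : IsConcaveTail (b n / c n) fun x => n * (1 - F (c n * -x + b n)) := by
  have h := hF.const_mul_comp_affine (b n) n.cast_nonneg (hc n)
  rw [zero_add] at h
  convert h using 5
  ring

theorem limit_pos_of_isConcaveTail (hdf : IsDistributionFunction F)
    (hF : IsConcaveTail 0 fun y => 1 - F (-y)) (hG : IsDistributionFunction G)
    (hnd : ¬ IsDegenerate G) (hc : ∀ n, 0 < c n)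
    (hw : WeaklyConverges (fun n x => F (c n * x + b n) ^ n) G) (x : ℝ) : 0 < G x := by
  obtain ⟨y, z, hyz, hy, hz, hGy, hGz⟩ := hG.exists_continuousAt_mem_Ioo_pair hnd
  obtain ⟨u, ⟨-, hu⟩, hGu⟩ := exists_continuousAt_mem_Ioo hG.monotone (sub_one_lt (min x y))
  obtain ⟨hux, huy⟩ := lt_min_iff.1 hu
  refine lt_of_lt_of_le ?_ (hG.monotone hux.le)
  set K := -Real.log (G y) + 1
  have hK : ∀ᶠ n : ℕ in atTop, n * (1 - F (c n * y + b n)) < K :=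
    (tendsto_natCast_mul_one_sub_of_tendsto_pow (fun n => hdf.nonneg _) hGy
      (hw y hy)).eventually_lt_const (lt_add_one _)
  -- The chord of the concave tail from `-z` through `-y` bounds its value at the far point `-u`.
  refine pos_of_tendsto_pow (M := (z - u) * K / (z - y)) ?_ (hw u hGu)
  filter_upwards [(hw z hz).eventually_lt_const hGz, hK, eventually_ne_atTop 0]
    with n hn hKn hn0
  have hφ := isConcaveTail_normed (b := b) hF hc n
  have hbz : b n / c n < -z := hφ.lt_of_pos <| by
    rw [neg_neg]
    have hFz : F (c n * z + b n) < 1 := (pow_lt_one_iff_of_nonneg (hdf.nonneg _) hn0).1 hn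
    exact mul_pos (Nat.cast_pos.2 (Nat.pos_of_ne_zero hn0)) (sub_pos.2 hFz)
  have hchord := hφ.sub_mul_le_sub_mul hbz.le (neg_lt_neg hyz) (neg_lt_neg huy)
  simp only [neg_neg, neg_sub_neg] at hchord
  rw [le_div_iff₀' (sub_pos.2 hyz)]
  exact hchord.trans (mul_le_mul_of_nonneg_left hKn.le (sub_pos.2 (huy.trans hyz)).le)

theorem exists_tendsto_tail (hdf : IsDistributionFunction F)
    (hF : IsConcaveTail 0 fun y => 1 - F (-y)) (hG : IsDistributionFunction G)
    (hnd : ¬ IsDegenerate G) (hc : ∀ n, 0 < c n)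
    (hw : WeaklyConverges (fun n x => F (c n * x + b n) ^ n) G) :
    ∃ k : ℝ → ℝ, StrictMonoOn k (Ioi 0) ∧ ContinuousOn k (Ioi 0) ∧
      ∀ y, 0 < y → Tendsto (fun n : ℕ => n * (1 - F (-(c n * y)))) atTop (𝓝 (k y)) := by
  have hpos := limit_pos_of_isConcaveTail hdf hF hG hnd hc hw
  obtain ⟨k, hkmono, hkcont, hklim⟩ := exists_tendsto_add_endpoint
    (fun n => isConcaveTail_normed (b := b) hF hc n) (hG.monotone_neg_log_comp_neg hpos)
    (fun x => hG.neg_log_nonneg _) (hG.tendsto_neg_log_comp_neg_atTop hpos)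
    fun x hx => tendsto_natCast_mul_one_sub_of_tendsto_pow (fun n => hdf.nonneg _) (hpos _)
      (hw _ (continuousAt_neg_of_continuousAt_neg_log hpos hx))
  refine ⟨k, hkmono, hkcont, fun y hy => (hklim y hy).congr fun n => ?_⟩
  have hshift : c n * -(y + b n / c n) + b n = -(c n * y) := by
    have := (hc n).ne'
    field_simp
    ring
  rw [hshift]

end DomainOfAttraction

section Weibull

variable {F : ℝ → ℝ} {α : ℝ}

theorem weibullDF_eq_exp_max (hα : α ≠ 0) :
    weibullDF α = fun x => Real.exp (-(max (-x) 0 ^ α)) := by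
  funext x
  unfold weibullDF
  split_ifs with hx
  · rw [max_eq_left (neg_pos.2 hx).le]
  · rw [max_eq_right (neg_nonpos.2 (not_lt.1 hx)), Real.zero_rpow hα, neg_zero, Real.exp_zero]

theorem isDistributionFunction_weibullDF (hα : 0 < α) :
    IsDistributionFunction (weibullDF α) := by
  have hcont : Continuous (weibullDF α) := by
    rw [weibullDF_eq_exp_max hα.ne']
    exact ((continuous_neg.max continuous_const).rpow_const fun _ => Or.inr hα.le).neg.rexp
  refine ⟨fun x y hxy => ?_, fun x => hcont.continuousWithinAt, ?_, ?_⟩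
  · rw [weibullDF_eq_exp_max hα.ne']
    exact Real.exp_le_exp.2 (neg_le_neg (Real.rpow_le_rpow (le_max_right _ _)
      (max_le_max_right 0 (neg_le_neg hxy)) hα.le))
  · rw [weibullDF_eq_exp_max hα.ne']
    exact Real.tendsto_exp_atBot.comp (tendsto_neg_atTop_atBot.comp ((tendsto_rpow_atTop hα).comp
      (tendsto_atTop_mono (fun x => le_max_left _ _) tendsto_neg_atBot_atTop)))
  · exact tendsto_const_nhds.congr'
      ((eventually_ge_atTop 0).mono fun x hx => (if_neg (not_lt.2 hx)).symm)

theorem not_isDegenerate_weibullDF (α : ℝ) : ¬ IsDegenerate (weibullDF α) := by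
  rintro ⟨a, ha⟩
  have hval : weibullDF α (-1) = Real.exp (-1) := by simp [weibullDF]
  have hmem : Real.exp (-1) = 0 ∨ Real.exp (-1) = 1 := by
    rw [← hval, ha]
    exact (ite_eq_or_eq _ _ _).symm
  norm_num [(Real.exp_pos (-1)).ne'] at hmem

theorem inMDA_weibullDF_of_tendsto_tail (hdf : IsDistributionFunction F)
    (hF : ∀ x, 0 ≤ x → F x = 1) (hα : 0 < α) {a : ℕ → ℝ} (ha : ∀ n, 0 < a n)
    (hlim : ∀ y, 0 < y → Tendsto (fun n : ℕ => n * (1 - F (-(a n * y)))) atTop (𝓝 (y ^ α))) :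
    InMDA F (weibullDF α) := by
  refine ⟨hdf, isDistributionFunction_weibullDF hα, not_isDegenerate_weibullDF α, a, fun _ => 0,
    ha, fun x _ => ?_⟩
  rcases lt_or_ge x 0 with hx | hx
  · have hexp := Real.tendsto_one_add_pow_exp_of_tendsto
      (g := fun n => -(1 - F (-(a n * -x))))
      ((hlim (-x) (neg_pos.2 hx)).neg.congr fun n => (mul_neg _ _).symm)
    rw [weibullDF, if_pos hx]
    simpa only [neg_sub, add_sub_cancel, mul_neg, neg_neg, add_zero] using hexp
  · rw [weibullDF, if_neg (not_lt.2 hx)]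
    refine tendsto_const_nhds.congr fun n => ?_
    simp only [add_zero, hF _ (mul_nonneg (ha n).le hx), one_pow]

theorem exists_norming_of_tendsto_tail_rpow (hα : 0 < α) {h : ℝ → ℝ} {c : ℕ → ℝ}
    (hc : ∀ n, 0 < c n) {κ : ℝ} (hκ : 0 < κ)
    (hlim : ∀ y, 0 < y → Tendsto (fun n : ℕ => n * h (c n * y)) atTop (𝓝 (κ * y ^ α))) :
    ∃ a : ℕ → ℝ, (∀ n, 0 < a n) ∧
      ∀ y, 0 < y → Tendsto (fun n : ℕ => n * h (a n * y)) atTop (𝓝 (y ^ α)) := by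
  have hs : 0 < κ ^ (-α⁻¹) := Real.rpow_pos_of_pos hκ _
  have hsα : κ * (κ ^ (-α⁻¹)) ^ α = 1 := by
    rw [← Real.rpow_mul hκ.le, neg_mul, inv_mul_cancel₀ hα.ne', Real.rpow_neg_one,
      mul_inv_cancel₀ hκ.ne']
  refine ⟨fun n => c n * κ ^ (-α⁻¹), fun n => mul_pos (hc n) hs, fun y hy => ?_⟩
  have hy' := hlim _ (mul_pos hs hy)
  rw [Real.mul_rpow hs.le hy.le, ← mul_assoc, hsα, one_mul] at hy'
  simpa only [mul_assoc] using hy'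

end Weibull

theorem InMDA.exists_inMDA_weibullDF {F G : ℝ → ℝ} (h : InMDA F G)
    (hF : IsConcaveTail 0 fun y => 1 - F (-y)) : ∃ α ∈ Ioc (0 : ℝ) 1, InMDA F (weibullDF α) := by
  obtain ⟨hdf, hG, hnd, c, b, hc, hw⟩ := h
  obtain ⟨k, hkmono, hkcont, hklim⟩ := exists_tendsto_tail hdf hF hG hnd hc hw
  have htail : ∀ y, 0 < y → 0 < 1 - F (-y) := by
    obtain ⟨x, hx⟩ := (hdf.tendsto_atBot.eventually_lt_const one_pos).exists
    exact fun y hy => hF.pos (x := -x) (by simpa using hx) hy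
  obtain ⟨α, hα, hrv, hk⟩ := exists_isRegularlyVarying_of_tendsto_natCast_mul hF.monotone htail
    hc hklim hkmono hkcont
  obtain ⟨a, ha, halim⟩ := exists_norming_of_tendsto_tail_rpow (h := fun y => 1 - F (-y)) hα hc
    (pos_of_tendsto_natCast_mul htail hc hklim hkmono one_pos) fun y hy => hk y hy ▸ hklim y hy
  have hF1 : ∀ x, 0 ≤ x → F x = 1 := fun x hx => by
    have := hF.eq_zero_of_le (-x) (neg_nonpos.2 hx)
    rw [neg_neg] at this
    exact (sub_eq_zero.1 this).symm
  exact ⟨α, ⟨hα, (hrv.mem_Icc_of_concaveOn hF.concaveOn (hF.nonneg 0)).2⟩,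
    inMDA_weibullDF_of_tendsto_tail hdf hF1 hα ha halim⟩

theorem isConcaveTail_one_sub_reflectedDF {ψ : ℝ → ℝ} (h0 : ψ 0 = 1)
    (hψ : ConvexOn ℝ (Ici 0) ψ) (hdf : IsDistributionFunction (reflectedDF ψ)) :
    IsConcaveTail 0 fun y => 1 - reflectedDF ψ (-y) where
  nonneg y := sub_nonneg.2 (hdf.le_one _)
  eq_zero_of_le y hy := by
    rcases hy.eq_or_lt with rfl | hy
    · simp [reflectedDF, h0]
    · simp [reflectedDF, hy.not_ge]
  concaveOn := ((concaveOn_const 1 (convex_Ici 0)).sub hψ).congr fun y hy => by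
    simp [reflectedDF, mem_Ici.1 hy]

end ArchEVT

theorem mainTheorem6_general {ψ : ℝ → ℝ} (h0 : ψ 0 = 1) (hψ : ConvexOn ℝ (Ici 0) ψ) :
    ((∀ α : ℝ, ArchEVT.IsRegularlyVarying (fun x => 1 - ψ x⁻¹) (-α) → α ∈ Icc (0 : ℝ) 1) ∧
      ¬ ArchEVT.IsRapidlyVarying (fun x => 1 - ψ x⁻¹)) ∧
    ((∃ G : ℝ → ℝ, ArchEVT.InMDA (ArchEVT.reflectedDF ψ) G) →
      ∃ α : ℝ, α ∈ Ioc (0 : ℝ) 1 ∧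
        ArchEVT.InMDA (ArchEVT.reflectedDF ψ) (ArchEVT.weibullDF α)) := by
  have hconc : ConcaveOn ℝ (Ici 0) fun x => 1 - ψ x := (concaveOn_const 1 (convex_Ici 0)).sub hψ
  have hzero : 0 ≤ 1 - ψ 0 := (sub_eq_zero.2 h0.symm).ge
  refine ⟨⟨fun α hα => hα.mem_Icc_of_concaveOn hconc hzero,
    ArchEVT.not_isRapidlyVarying_of_concaveOn hconc hzero⟩, ?_⟩
  rintro ⟨G, hG⟩
  exact hG.exists_inMDA_weibullDF (ArchEVT.isConcaveTail_one_sub_reflectedDF h0 hψ hG.left)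

theorem mainTheorem6 (d : ℕ) (ψ : ℝ → ℝ)
    (hψ : ArchEVT.IsArchimedeanGenerator ψ) (hd : ArchEVT.IsDMonotone d ψ) :
    ((∀ α : ℝ, ArchEVT.IsRegularlyVarying (fun x => 1 - ψ x⁻¹) (-α) → α ∈ Set.Icc (0 : ℝ) 1) ∧
      ¬ ArchEVT.IsRapidlyVarying (fun x => 1 - ψ x⁻¹)) ∧
    ((∃ G : ℝ → ℝ, ArchEVT.InMDA (ArchEVT.reflectedDF ψ) G) →
      ∃ α : ℝ, α ∈ Set.Ioc (0 : ℝ) 1 ∧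
        ArchEVT.InMDA (ArchEVT.reflectedDF ψ) (ArchEVT.weibullDF α)) := by
  exact mainTheorem6_general hψ.map_zero
    (closure_Ioi (0 : ℝ) ▸ ArchEVT.convexOn_closure hd.convexOn_Ioi
      (by simpa only [closure_Ioi] using hψ.continuousOn))
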